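/- **Setting.** Categories may be of any size. *Monads.* Let $\mathbf{Mnd}(\mathbf{Cat})$ be the 2-category whose objects are pairs $(\mathcal C,S)$ of a category and a monad on it, whose 1-cells $(J,\psi):(\mathcal C,S)\to(\mathcal D,T)$ are functors $J:\mathcal C\to\mathcal D$ with a natural transformation $\psi:TJ\to JS$ satisfying $\psi\circ\mu^TJ=J\mu^S\circ\psi S\circ T\psi$ and $\psi\circ\eta^TJ=J\eta^S$, and whose 2-cells $(J,\psi)\to(J',\psi')$ are natural transformations $\theta:J\to J'$ with $\psi'\circ T\theta=\theta S\circ\psi$. *Adjunctions.* Let $\mathbf{Adj}_R(\mathbf{Cat})$ be the 2-category whose objects are adjunctions $L\dashv R$ (with $L:\mathcal C\to\mathcal X$), whose 1-cells from $L\dashv R$ to $L'\dashv R'$ are triples $(J,V,\lambda)$ with $J:\mathcal C\to\mathcal D$, $V:\mathcal X\to\mathcal Y$, $\lambda:L'J\to VL$ such that the mate $\varrho:JR\to R'V$ of $\lambda$ is invertible, and whose 2-cells $(J,V,\lambda)\to(J',V',\lambda')$ are pairs $\alpha:J\to J'$, $\beta:V\to V'$ with $\beta L\circ\lambda=\lambda'\circ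 L'\alpha$. The 2-functor $\Phi:\mathbf{Adj}_R(\mathbf{Cat})\to\mathbf{Mnd}(\mathbf{Cat})$ sends $L\dashv R$ to the monad $RL$, $(J,V,\lambda)$ to $(J,\varrho^{-1}L\circ R'\lambda)$ and $(\alpha,\beta)$ to $\alpha$. The 2-functor $\Psi:\mathbf{Mnd}(\mathbf{Cat})\to\mathbf{Adj}_R(\mathbf{Cat})$ sends $(\mathcal C,S)$ to the Eilenberg–Moore adjunction $F^S\dashv U^S$ and $(J,\psi)$ to $(J,J^\psi,\lambda)$, where $J^\psi:\mathcal C^S\to\mathcal D^T$ is $(A,a)\mapsto(JA,\,Ja\circ\psi_A)$ and $\lambda$ has components $\psi$. The unit of the 2-adjunction $\Phi\dashv\Psi$ is the Eilenberg–Moore comparison, the counit is the identity, and the hom-isomorphism sends a 1-cell $(J,\psi):\Phi(L\dashv R)\to(\mathcal D,T)$ to $\Psi(J,\psi)$ precomposed with the comparison, and a 1-cell in $\mathbf{Adj}_R(\mathbf{Cat})$ from $L\dashv R$ to $F^T\dashv U^T$ to its image under $\Phi$ followed by the counit. *Parametric adjunctions.* For $J:\mathcal C\times\mathcal Q\to\mathcal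 D$ and $K:\mathcal Q^{op}\times\mathcal D\to\mathcal C$, a parametric adjunction $J\dashv_{\mathcal Q}K$ is a family of adjunctions $J(-,q)\dashv K(q,-)$, $q\in\mathcal Q$, whose hom-bijections are natural also in $q$. *Hopf parametric adjunctions.* A Hopf parametric adjunction over $\mathcal Q$ in $\mathbf{Mnd}(\mathbf{Cat})$ between $(J,\psi):(\mathcal C\times\mathcal Q,S\times 1)\to(\mathcal D,T)$ and $(K,\psi'):(\mathcal Q^{op}\times\mathcal D,1\times T)\to(\mathcal C,S)$, where $\psi$ is invertible, is a parametric adjunction $J\dashv_{\mathcal Q}K$ such that for every $q$ the unit and counit of $J(-,q)\dashv K(q,-)$ are 2-cells of monads, i.e. $(J(-,q),\psi(-,q))\dashv(K(q,-),\psi'(q,-))$ in $\mathbf{Mnd}(\mathbf{Cat})$. A Hopf parametric adjunction over $\mathcal Q$ in $\mathbf{Adj}_R(\mathbf{Cat})$ between $(J,V,\lambda)$ from $L\times\mathcal Q\dashv R\times\mathcal Q$ to $L'\dashv R'$ and $(K,W,\lambda')$ from $\mathcal Q^{op}\times L'\dashv\mathcal Q^{op}\times R'$ to $L\dashv R$,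 where $\lambda$ is invertible, is a pair of parametric adjunctions $J\dashv_{\mathcal Q}K$ and $V\dashv_{\mathcal Q}W$ such that for every $q$ the pair of units and the pair of counits at $q$ are 2-cells of $\mathbf{Adj}_R(\mathbf{Cat})$. *Hopf operators.* Let $S$, $E$, $T$ be monads on $\mathcal C$, $\mathcal P$, $\mathcal D$, and let $U^E:\mathcal P^E\to\mathcal P$ be the forgetful functor of the category of $E$-algebras. The left Hopf operator of a 1-cell $(J,\psi):(\mathcal C\times\mathcal P,S\times E)\to(\mathcal D,T)$ is the transformation $H(\psi):TJ(\mathcal C\times U^E)\to J(\mathcal C\times U^E)(S\times\mathcal P^E)$ with component $J(SC,k)\circ\psi_{(C,M)}$ at $(C,(M,k))$; with it $(J(\mathcal C\times U^E),H(\psi)):(\mathcal C\times\mathcal P^E,S\times 1)\to(\mathcal D,T)$ is a 1-cell in $\mathbf{Mnd}(\mathbf{Cat})$. The 1-cell $(J,\psi)$ is left Hopf if $H(\psi)$ is invertible. If moreover $J\dashv_{\mathcal P}K$, then $H^\sharp(\psi):SK(U^{E\,op}\times\mathcal D)\to K(U^{E\,op}\times\mathcal D)((\mathcal P^E)^{op}\times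 T)$ is the transformation which at $(M,k)$ is the mate of $H(\psi)^{-1}(-,(M,k))$ under $J(-,M)\dashv K(M,-)$; with it $K(U^{E\,op}\times\mathcal D)$ is a 1-cell $((\mathcal P^E)^{op}\times\mathcal D,1\times T)\to(\mathcal C,S)$. **Theorem.** Let $(J,\psi):(\mathcal C\times\mathcal P,S\times E)\to(\mathcal D,T)$ be a left Hopf 1-cell in $\mathbf{Mnd}(\mathbf{Cat})$ and $J\dashv_{\mathcal P}K$ a parametric adjunction. Let $$\big(J(\mathcal C\times U^E),[J(\mathcal C\times U^E)]^{H\psi},\lambda^{H\psi}\big):\ F^S\times\mathcal P^E\dashv U^S\times\mathcal P^E\ \longrightarrow\ F^T\dashv U^T,$$ $$\big(K(U^{E\,op}\times\mathcal D),[K(U^{E\,op}\times\mathcal D)]^{H\sharp\psi},\lambda^{H\sharp\psi}\big):\ (\mathcal P^E)^{op}\times F^T\dashv(\mathcal P^E)^{op}\times U^T\ \longrightarrow\ F^S\dashv U^S$$ be the 1-cells in $\mathbf{Adj}_R(\mathbf{Cat})$ assigned by the hom-isomorphisms of $\Phi\dashv\Psi$ to $(J(\mathcal C\times U^E),H(\psi))$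 and $(K(U^{E\,op}\times\mathcal D),H^\sharp(\psi))$. Then the hom-isomorphisms in the other direction send them back to $(J(\mathcal C\times U^E),H(\psi))$ and $(K(U^{E\,op}\times\mathcal D),H^\sharp(\psi))$, and there is a bijection between 1. Hopf parametric adjunctions in $\mathbf{Adj}_R(\mathbf{Cat})$ $$\big(J(\mathcal C\times U^E),[J(\mathcal C\times U^E)]^{H\psi},\lambda^{H\psi}\big)\dashv_{\mathcal P^E}\big(K(U^{E\,op}\times\mathcal D),[K(U^{E\,op}\times\mathcal D)]^{H\sharp\psi},\lambda^{H\sharp\psi}\big);$$ 2. Hopf parametric adjunctions in $\mathbf{Mnd}(\mathbf{Cat})$ $$\big(J(\mathcal C\times U^E),H(\psi)\big)\dashv_{\mathcal P^E}\big(K(U^{E\,op}\times\mathcal D),H^\sharp(\psi)\big).$$ The bijection is given by $\Phi$ on units and counits: it sends a structure in 1 to its parametric adjunction $J(\mathcal C\times U^E)\dashv_{\mathcal P^E}K(U^{E\,op}\times\mathcal D)$; and its inverse lifts a structure in 2 to algebras, so that at every $E$-algebra the unit and counit of $[J(\mathcal C\times U^E)]^{H\psi}\dashv_{\mathcal P^E}[K(U^{E\,op}\times\mathcal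 D)]^{H\sharp\psi}$ have as underlying morphisms the unit and counit of $J(\mathcal C\times U^E)\dashv_{\mathcal P^E}K(U^{E\,op}\times\mathcal D)$. Both sets are nonempty: the restriction of $J\dashv_{\mathcal P}K$ along $U^E$ is a structure in 2. -/

import Mathlib

open CategoryTheory CategoryTheory.Functor Opposite
open scoped CategoryTheory.Prod
open scoped TwoSquare

universe v₁ v₂ v₃ v₄ v₅ v₆ u₁ u₂ u₃ u₄ u₅ u₆

namespace HopfParametric

section Monads

variable {C : Type u₁} [Category.{v₁} C] {D : Type u₂} [Category.{v₂} D]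
  {P : Type u₃} [Category.{v₃} P]

/-- The product monad `S × E` on `C × P`. -/
@[simps!]
def prodMonad (S : Monad C) (E : Monad P) : Monad (C × P) where
  toFunctor := S.toFunctor.prod E.toFunctor
  η := NatTrans.prod S.η E.η
  μ := NatTrans.prod S.μ E.μ
  assoc X := Prod.hom_ext (S.assoc X.1) (E.assoc X.2)
  left_unit X := Prod.hom_ext (S.left_unit X.1) (E.left_unit X.2)
  right_unit X := Prod.hom_ext (S.right_unit X.1) (E.right_unit X.2)

/-- A 1-cell `(J, ψ) : (C, S) ⟶ (D, T)` of the 2-category `Mnd(Cat)`: a functor `J : C ⥤ D` and a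
natural transformation `ψ : T J ⟶ J S` with `ψ ∘ μ^T J = J μ^S ∘ ψ S ∘ T ψ` and
`ψ ∘ η^T J = J η^S`. -/
structure MndHom (S : Monad C) (T : Monad D) where
  functor : C ⥤ D
  ψ : functor ⋙ T.toFunctor ⟶ S.toFunctor ⋙ functor
  mul_comp : ∀ X : C, T.μ.app (functor.obj X) ≫ ψ.app X =
    T.map (ψ.app X) ≫ ψ.app (S.obj X) ≫ functor.map (S.μ.app X)
  unit_comp : ∀ X : C, T.η.app (functor.obj X) ≫ ψ.app X = functor.map (S.η.app X)

namespace MndHom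

variable {S : Monad C} {T : Monad D} {E : Monad P}

/-- The identity 1-cell of a monad. -/
def id (S : Monad C) : MndHom S S where
  functor := 𝟭 C
  ψ := { app := fun X => 𝟙 (S.obj X) }
  mul_comp X := by simp
  unit_comp X := by simp

/-- Composition of 1-cells of `Mnd(Cat)`. -/
def comp (f : MndHom S T) (g : MndHom T E) : MndHom S E where
  functor := f.functor ⋙ g.functor
  ψ := { app := fun X => g.ψ.app (f.functor.obj X) ≫ g.functor.map (f.ψ.app X)
         naturality := fun X Y h => by
          have h1 := g.ψ.naturality (f.functor.map h)
          have h2 := f.ψ.naturality h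
          dsimp at h1 h2 ⊢
          rw [← Category.assoc, h1, Category.assoc, ← g.functor.map_comp, h2, Category.assoc,
            ← g.functor.map_comp] }
  mul_comp X := by
    have h1 := g.mul_comp (f.functor.obj X)
    have h2 := f.mul_comp X
    have h3 := g.ψ.naturality (f.ψ.app X)
    dsimp at h1 h2 h3 ⊢
    rw [← Category.assoc, h1]
    simp only [Category.assoc, Functor.map_comp]
    rw [← g.functor.map_comp, h2]
    simp only [Functor.map_comp]
    rw [← Category.assoc (E.map (g.functor.map _)), h3, Category.assoc]
  unit_comp X := by
    have h1 := g.unit_comp (f.functor.obj X)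
    have h2 := f.unit_comp X
    dsimp at h1 h2 ⊢
    rw [← Category.assoc, h1, ← g.functor.map_comp, h2]

/-- A natural transformation `θ : J ⟶ J'` is a 2-cell `(J, ψ) ⟶ (J', ψ')` of `Mnd(Cat)`:
`ψ' ∘ T θ = θ S ∘ ψ`. -/
def IsTwoCell (f g : MndHom S T) (θ : f.functor ⟶ g.functor) : Prop :=
  ∀ X : C, T.map (θ.app X) ≫ g.ψ.app X = f.ψ.app X ≫ θ.app (S.obj X)

/-- The adjunction `adj` of the underlying functors is an adjunction `(J, ψ) ⊣ (K, ψ')` inside the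
2-category `Mnd(Cat)`: its unit and counit are 2-cells of monads (the triangle identities are those
of `adj`). -/
structure IsAdjointObject (f : MndHom S T) (g : MndHom T S) (adj : f.functor ⊣ g.functor) :
    Prop where
  unit : IsTwoCell (MndHom.id S) (f.comp g) adj.unit
  counit : IsTwoCell (g.comp f) (MndHom.id T) adj.counit

end MndHom
end Monads

section Adj
variable {C : Type u₁} [Category.{v₁} C] {D : Type u₂} [Category.{v₂} D]
  {X : Type u₃} [Category.{v₃} X] {Y : Type u₄} [Category.{v₄} Y]

/-- A 1-cell `(J, V, λ)` of the 2-category `Adj_R(Cat)` from `L ⊣ R` to `L' ⊣ R'`: functors `J` and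
`V` and a natural transformation `λ : L' J ⟶ V L` whose mate `ρ : J R ⟶ R' V` is invertible. -/
structure AdjHom {L : C ⥤ X} {R : X ⥤ C} {L' : D ⥤ Y} {R' : Y ⥤ D} (a : L ⊣ R) (b : L' ⊣ R') where
  top : C ⥤ D
  bot : X ⥤ Y
  lam : top ⋙ L' ⟶ L ⋙ bot
  isIso_mate : IsIso (mateEquiv a b (TwoSquare.mk top L L' bot lam)).natTrans

variable {L : C ⥤ X} {R : X ⥤ C} {L' : D ⥤ Y} {R' : Y ⥤ D} {a : L ⊣ R} {b : L' ⊣ R'}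

/-- The mate `ρ : J R ⟶ R' V` of `λ`. -/
def AdjHom.rho (f : AdjHom a b) : R ⋙ f.top ⟶ f.bot ⋙ R' :=
  (mateEquiv a b (TwoSquare.mk f.top L L' f.bot f.lam)).natTrans

lemma AdjHom.rho_app (f : AdjHom a b) (x : X) : f.rho.app x =
    b.unit.app (f.top.obj (R.obj x)) ≫ R'.map (f.lam.app (R.obj x)) ≫
      R'.map (f.bot.map (a.counit.app x)) := by
  simp [AdjHom.rho]

lemma AdjHom.rho_counit (f : AdjHom a b) (x : X) :
    L'.map (f.rho.app x) ≫ b.counit.app (f.bot.obj x) =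
      f.lam.app (R.obj x) ≫ f.bot.map (a.counit.app x) :=
  mateEquiv_counit a b (TwoSquare.mk f.top L L' f.bot f.lam) x

lemma AdjHom.unit_lam (f : AdjHom a b) (c : C) :
    b.unit.app (f.top.obj c) ≫ R'.map (f.lam.app c) =
      f.top.map (a.unit.app c) ≫ f.rho.app (L.obj c) :=
  (unit_mateEquiv a b (TwoSquare.mk f.top L L' f.bot f.lam) c).symm

instance (f : AdjHom a b) : IsIso f.rho := f.isIso_mate

/-- A 1-cell of `Adj_R(Cat)` from data `(J, V, λ)` for which the components of the mate, written
out, are invertible. -/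
def AdjHom.mk' (J : C ⥤ D) (V : X ⥤ Y) (lam : J ⋙ L' ⟶ L ⋙ V)
    (h : ∀ x : X, IsIso (b.unit.app (J.obj (R.obj x)) ≫ R'.map (lam.app (R.obj x)) ≫
      R'.map (V.map (a.counit.app x)))) : AdjHom a b where
  top := J
  bot := V
  lam := lam
  isIso_mate := by
    have : ∀ x, IsIso ((mateEquiv a b (TwoSquare.mk J L L' V lam)).natTrans.app x) := fun x => by
      have := h x
      simpa using this
    exact NatIso.isIso_of_isIso_app _

/-- The identity 1-cell of an adjunction. -/
def AdjHom.id (a : L ⊣ R) : AdjHom a a :=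
  AdjHom.mk' (𝟭 C) (𝟭 X) { app := fun c => 𝟙 (L.obj c) } fun x => by
    dsimp
    simp only [CategoryTheory.Functor.map_id, Category.id_comp, Adjunction.right_triangle_components]
    infer_instance

/-- A pair `α : J ⟶ J'`, `β : V ⟶ V'` is a 2-cell `(J, V, λ) ⟶ (J', V', λ')` of `Adj_R(Cat)`:
`β L ∘ λ = λ' ∘ L' α`. -/
def AdjHom.IsTwoCell (f g : AdjHom a b) (α : f.top ⟶ g.top) (β : f.bot ⟶ g.bot) : Prop :=
  ∀ c : C, f.lam.app c ≫ β.app (L.obj c) = L'.map (α.app c) ≫ g.lam.app c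

lemma AdjHom.toMndHom_naturality (f : AdjHom a b) {c c' : C} (h : c ⟶ c') :
    R'.map (L'.map (f.top.map h)) ≫ R'.map (f.lam.app c') ≫ (inv f.rho).app (L.obj c') =
      (R'.map (f.lam.app c) ≫ (inv f.rho).app (L.obj c)) ≫ f.top.map (R.map (L.map h)) := by
  have h1 := f.lam.naturality h
  have h2 := (inv f.rho).naturality (L.map h)
  dsimp at h1 h2 ⊢
  rw [Category.assoc, ← h2, ← Category.assoc, ← R'.map_comp, h1, R'.map_comp, Category.assoc]

lemma AdjHom.toMndHom_mul_comp (f : AdjHom a b) (c : C) :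
    R'.map (b.counit.app (L'.obj (f.top.obj c))) ≫ R'.map (f.lam.app c) ≫
        (inv f.rho).app (L.obj c) =
      R'.map (L'.map (R'.map (f.lam.app c) ≫ (inv f.rho).app (L.obj c))) ≫
        (R'.map (f.lam.app (R.obj (L.obj c))) ≫ (inv f.rho).app (L.obj (R.obj (L.obj c)))) ≫
          f.top.map (R.map (a.counit.app (L.obj c))) := by
  have h1 := (inv f.rho).naturality (a.counit.app (L.obj c))
  have h2 := f.rho_counit (L.obj c)
  have h3 := b.counit.naturality (f.lam.app c)
  dsimp at h1 h2 h3 ⊢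
  simp only [Functor.map_comp, Category.assoc]
  rw [← h1]
  have h4 : L'.map ((inv f.rho).app (L.obj c)) ≫ f.lam.app (R.obj (L.obj c)) ≫
      f.bot.map (a.counit.app (L.obj c)) = b.counit.app _ := by
    rw [← h2, ← Category.assoc, ← L'.map_comp, ← NatTrans.comp_app, IsIso.inv_hom_id]
    simp
  rw [← R'.map_comp_assoc, ← h3, ← h4]
  simp only [Functor.map_comp, Category.assoc]

lemma AdjHom.toMndHom_unit_comp (f : AdjHom a b) (c : C) :
    b.unit.app (f.top.obj c) ≫ R'.map (f.lam.app c) ≫ (inv f.rho).app (L.obj c) =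
      f.top.map (a.unit.app c) := by
  have h := f.unit_lam c
  rw [← Category.assoc, h, Category.assoc, ← NatTrans.comp_app, IsIso.hom_inv_id]
  simp

/-- The 2-functor `Φ : Adj_R(Cat) ⥤ Mnd(Cat)` on 1-cells: `L ⊣ R` goes to the monad `R L`, and
`(J, V, λ)` to `(J, ρ⁻¹ L ∘ R' λ)`. On 2-cells it sends `(α, β)` to `α`. -/
noncomputable def AdjHom.toMndHom (f : AdjHom a b) : MndHom a.toMonad b.toMonad where
  functor := f.top
  ψ := { app := fun c => R'.map (f.lam.app c) ≫ (inv f.rho).app (L.obj c)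
         naturality := fun _ _ h => f.toMndHom_naturality h }
  mul_comp c := f.toMndHom_mul_comp c
  unit_comp c := f.toMndHom_unit_comp c
end Adj

section AdjComp
variable {C : Type u₁} [Category.{v₁} C] {D : Type u₂} [Category.{v₂} D]
  {X : Type u₃} [Category.{v₃} X] {Y : Type u₄} [Category.{v₄} Y]
  {B : Type u₅} [Category.{v₅} B] {Z : Type u₆} [Category.{v₆} Z]
  {L : C ⥤ X} {R : X ⥤ C} {L' : D ⥤ Y} {R' : Y ⥤ D} {L'' : B ⥤ Z} {R'' : Z ⥤ B}
  {a : L ⊣ R} {b : L' ⊣ R'} {c : L'' ⊣ R''}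

/-- The transformation `λ` of a composite: `V' λ ∘ λ' J`. -/
def AdjHom.compLam (f : AdjHom a b) (g : AdjHom b c) :
    (f.top ⋙ g.top) ⋙ L'' ⟶ L ⋙ f.bot ⋙ g.bot where
  app x := g.lam.app (f.top.obj x) ≫ g.bot.map (f.lam.app x)
  naturality x x' h := by
    have h1 := g.lam.naturality (f.top.map h)
    have h2 := f.lam.naturality h
    dsimp at h1 h2 ⊢
    rw [← Category.assoc, h1, Category.assoc, ← g.bot.map_comp, h2, Category.assoc,
      ← g.bot.map_comp]

/-- Composition of 1-cells of `Adj_R(Cat)`. -/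
def AdjHom.comp (f : AdjHom a b) (g : AdjHom b c) : AdjHom a c where
  top := f.top ⋙ g.top
  bot := f.bot ⋙ g.bot
  lam := f.compLam g
  isIso_mate := by
    have e : TwoSquare.mk (f.top ⋙ g.top) L L'' (f.bot ⋙ g.bot) (f.compLam g) =
        TwoSquare.mk f.top L L' f.bot f.lam ≫ₕ TwoSquare.mk g.top L' L'' g.bot g.lam := by
      ext x
      simp [TwoSquare.hComp, AdjHom.compLam]
    rw [e, mateEquiv_vcomp a b c]
    have h : ∀ x, IsIso (((mateEquiv a b (TwoSquare.mk f.top L L' f.bot f.lam)) ≫ᵥ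
        (mateEquiv b c (TwoSquare.mk g.top L' L'' g.bot g.lam))).natTrans.app x) := by
      intro x
      have h3 : ((mateEquiv a b (TwoSquare.mk f.top L L' f.bot f.lam)) ≫ᵥ
          (mateEquiv b c (TwoSquare.mk g.top L' L'' g.bot g.lam))).natTrans.app x =
          g.top.map (f.rho.app x) ≫ g.rho.app (f.bot.obj x) := by
        simp [TwoSquare.vComp, AdjHom.rho]
      rw [h3]
      infer_instance
    exact NatIso.isIso_of_isIso_app _
end AdjComp

section More
variable {C : Type u₁} [Category.{v₁} C] {D : Type u₂} [Category.{v₂} D]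
  {X : Type u₃} [Category.{v₃} X] {Y : Type u₄} [Category.{v₄} Y]
  {Q : Type u₅} [Category.{v₅} Q] {P : Type u₆} [Category.{v₆} P]

/-- The product `L × L' ⊣ R × R'` of two adjunctions. -/
@[simps! unit counit]
def prodAdj {L : C ⥤ X} {R : X ⥤ C} {L' : D ⥤ Y} {R' : Y ⥤ D} (a : L ⊣ R) (b : L' ⊣ R') :
    L.prod L' ⊣ R.prod R' where
  unit := { app := fun Z => (a.unit.app Z.1, b.unit.app Z.2) }
  counit := { app := fun Z => (a.counit.app Z.1, b.counit.app Z.2) }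

/-- For a 1-cell `(J, ψ) : (C × Q, S × 1) ⟶ (D, T)` and an object `q` of `Q`, the 1-cell
`(J (-, q), ψ (-, q)) : (C, S) ⟶ (D, T)`. -/
def MndHom.atSnd {S : Monad C} {T : Monad D} (f : MndHom (prodMonad S (Monad.id Q)) T) (q : Q) :
    MndHom S T where
  functor := (curry.obj f.functor).flip.obj q
  ψ := { app := fun c => f.ψ.app (c, q)
         naturality := fun c c' h => f.ψ.naturality (X := (c, q)) (Y := (c', q)) (h, 𝟙 q) }
  mul_comp c := f.mul_comp (c, q)
  unit_comp c := f.unit_comp (c, q)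

/-- For a 1-cell `(K, ψ) : (Q × C, 1 × S) ⟶ (D, T)` and an object `q` of `Q`, the 1-cell
`(K (q, -), ψ (q, -)) : (C, S) ⟶ (D, T)`. -/
def MndHom.atFst {S : Monad C} {T : Monad D} (f : MndHom (prodMonad (Monad.id Q) S) T) (q : Q) :
    MndHom S T where
  functor := (curry.obj f.functor).obj q
  ψ := { app := fun c => f.ψ.app (q, c)
         naturality := fun c c' h => f.ψ.naturality (X := (q, c)) (Y := (q, c')) (𝟙 q, h) }
  mul_comp c := f.mul_comp (q, c)
  unit_comp c := f.unit_comp (q, c)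

section
variable {L : C ⥤ X} {R : X ⥤ C} {L' : D ⥤ Y} {R' : Y ⥤ D} {a : L ⊣ R} {b : L' ⊣ R'}

/-- For a 1-cell `(J, V, λ)` from `L × Q ⊣ R × Q` to `L' ⊣ R'` and an object `q` of `Q`, the 1-cell
`(J (-, q), V (-, q), λ (-, q))` from `L ⊣ R` to `L' ⊣ R'`. -/
def AdjHom.atSnd (f : AdjHom (prodAdj a (Adjunction.id (C := Q))) b) (q : Q) : AdjHom a b :=
  AdjHom.mk' ((curry.obj f.top).flip.obj q) ((curry.obj f.bot).flip.obj q)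
    { app := fun c => f.lam.app (c, q)
      naturality := fun c c' h => f.lam.naturality (X := (c, q)) (Y := (c', q)) (h, 𝟙 q) }
    (fun x => by
      have h : IsIso (f.rho.app (x, q)) := inferInstance
      rw [AdjHom.rho_app] at h
      exact h)

/-- The same as `AdjHom.atSnd`, with the parameter as first variable. -/
def AdjHom.atFst (f : AdjHom (prodAdj (Adjunction.id (C := Q)) a) b) (q : Q) : AdjHom a b :=
  AdjHom.mk' ((curry.obj f.top).obj q) ((curry.obj f.bot).obj q)
    { app := fun c => f.lam.app (q, c)
      naturality := fun c c' h => f.lam.naturality (X := (q, c)) (Y := (q, c')) (𝟙 q, h) }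
    (fun x => by
      have h : IsIso (f.rho.app (q, x)) := inferInstance
      rw [AdjHom.rho_app] at h
      exact h)

/-- Adjunctions `J ⊣ K` and `V ⊣ W` form an adjunction `(J, V, λ) ⊣ (K, W, λ')` inside the
2-category `Adj_R(Cat)`: the pair of units and the pair of counits are 2-cells. -/
structure AdjHom.IsAdjointObject (f : AdjHom a b) (g : AdjHom b a) (adjTop : f.top ⊣ g.top)
    (adjBot : f.bot ⊣ g.bot) : Prop where
  unit : IsTwoCell (AdjHom.id a) (f.comp g) adjTop.unit adjBot.unit
  counit : IsTwoCell (g.comp f) (AdjHom.id b) adjTop.counit adjBot.counit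

/-- The unit of the 2-adjunction `Φ ⊣ Ψ` at `L ⊣ R`: the identity functor together with the
Eilenberg-Moore comparison functor, from `L ⊣ R` to `F^{RL} ⊣ U^{RL}`. -/
def comparisonHom (a : L ⊣ R) : AdjHom a a.toMonad.adj :=
  AdjHom.mk' (𝟭 C) (Monad.comparison a)
    { app := fun c =>
        { f := 𝟙 (R.obj (L.obj c))
          h := by
            change R.map (L.map (𝟙 _)) ≫ R.map (a.counit.app (L.obj c)) =
              R.map (a.counit.app (L.obj c)) ≫ 𝟙 _
            simp }
      naturality := fun c c' h => by
        ext
        change R.map (L.map h) ≫ 𝟙 _ = 𝟙 _ ≫ R.map (L.map h)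
        simp }
    (fun x => by
      have e : a.toMonad.adj.unit.app (R.obj x) ≫ 𝟙 (R.obj (L.obj (R.obj x))) ≫
          R.map (a.counit.app x) = 𝟙 (R.obj x) := by
        have h : a.toMonad.adj.unit.app (R.obj x) = a.unit.app (R.obj x) := by
          simp
          rfl
        rw [h]
        exact (congrArg _ (Category.id_comp _)).trans (a.right_triangle_components x)
      change IsIso (a.toMonad.adj.unit.app (R.obj x) ≫ 𝟙 (R.obj (L.obj (R.obj x))) ≫
          R.map (a.counit.app x))
      rw [e]
      exact IsIso.id (R.obj x))
end

section
variable {S : Monad C} {T : Monad D}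

lemma MndHom.lift_unit (φ : MndHom S T) (A : S.Algebra) :
    T.η.app (φ.functor.obj A.A) ≫ φ.ψ.app A.A ≫ φ.functor.map A.a = 𝟙 (φ.functor.obj A.A) := by
  rw [← Category.assoc, φ.unit_comp, ← φ.functor.map_comp, A.unit]
  simp

/-- The functor `J^ψ` between the categories of algebras induced by a 1-cell `(J, ψ)`:
it sends `(A, a)` to `(J A, J a ∘ ψ A)`. -/
def MndHom.lift (φ : MndHom S T) : S.Algebra ⥤ T.Algebra where
  obj A :=
    { A := φ.functor.obj A.A
      a := φ.ψ.app A.A ≫ φ.functor.map A.a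
      unit := φ.lift_unit A
      assoc := by
        have h := φ.ψ.naturality A.a
        dsimp at h
        rw [← Category.assoc, φ.mul_comp, Functor.map_comp, Category.assoc, Category.assoc,
          Category.assoc, ← φ.functor.map_comp, A.assoc, Functor.map_comp, reassoc_of% h] }
  map h :=
    { f := φ.functor.map h.f
      h := by
        have h1 := φ.ψ.naturality h.f
        dsimp at h1 ⊢
        rw [← Category.assoc, h1, Category.assoc, ← φ.functor.map_comp, h.h, Category.assoc,
          ← φ.functor.map_comp] }

/-- The 2-functor `Ψ : Mnd(Cat) ⥤ Adj_R(Cat)` on 1-cells: `(C, S)` goes to `F^S ⊣ U^S`, and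
`(J, ψ)` to `(J, J^ψ, λ)`, where the components of `λ` are those of `ψ`. -/
def MndHom.toAdjHom (φ : MndHom S T) : AdjHom S.adj T.adj :=
  AdjHom.mk' φ.functor φ.lift
    { app := fun c =>
        { f := φ.ψ.app c
          h := (φ.mul_comp c).symm }
      naturality := fun c c' h => by
        ext
        exact φ.ψ.naturality h }
    (fun A => by
      have e : T.adj.unit.app (φ.functor.obj A.A) ≫ φ.ψ.app A.A ≫ φ.functor.map A.a =
          𝟙 (φ.functor.obj A.A) := by
        have h : T.adj.unit.app (φ.functor.obj A.A) = T.η.app (φ.functor.obj A.A) := by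
          simp
          rfl
        rw [h]
        exact φ.lift_unit A
      have e' : (S.adj.counit.app A).f = A.a := by
        simp
        rfl
      rw [← e'] at e
      exact e ▸ (inferInstance : IsIso (𝟙 (φ.functor.obj A.A))))

/-- The counit of the 2-adjunction `Φ ⊣ Ψ` at `(D, T)`: the identity 1-cell from `U^T F^T` to `T`. -/
def MndHom.counitHom (T : Monad D) : MndHom T.adj.toMonad T where
  functor := 𝟭 D
  ψ := { app := fun d => 𝟙 (T.obj d)
         naturality := fun d d' h => by
          change T.map h ≫ 𝟙 _ = 𝟙 _ ≫ T.map h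
          simp }
  mul_comp d := by
    have e : (T.adj.counit.app (T.free.obj d)).f = T.μ.app d := by
      simp
      rfl
    change T.μ.app d ≫ 𝟙 _ = T.map (𝟙 _) ≫ 𝟙 _ ≫ (T.adj.counit.app (T.free.obj d)).f
    rw [e]
    have h : T.μ.app d ≫ 𝟙 (T.obj d) =
        T.map (𝟙 (T.obj d)) ≫ 𝟙 (T.obj (T.obj d)) ≫ T.μ.app d := by
      rw [CategoryTheory.Functor.map_id]
      exact (Category.comp_id _).trans
        ((Category.id_comp _).trans (Category.id_comp _)).symm
    exact h
  unit_comp d := by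
    have e : T.adj.unit.app d = T.η.app d := by
      simp
      rfl
    change T.η.app d ≫ 𝟙 _ = T.adj.unit.app d
    rw [e]
    simp

/-- The identification of the monad of `F^S × Q ⊣ U^S × Q` with `S × 1`. -/
def MndHom.prodFreeHom (S : Monad C) (Q : Type u₅) [Category.{v₅} Q] :
    MndHom (prodAdj S.adj (Adjunction.id (C := Q))).toMonad (prodMonad S (Monad.id Q)) where
  functor := 𝟭 (C × Q)
  ψ := { app := fun X => 𝟙 ((S.obj X.1, X.2) : C × Q)
         naturality := fun X X' h => by
          ext
          · change S.map h.1 ≫ 𝟙 _ = 𝟙 _ ≫ S.map h.1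
            simp
          · change h.2 ≫ 𝟙 _ = 𝟙 _ ≫ h.2
            simp }
  mul_comp X := by
    ext
    · exact (MndHom.counitHom S).mul_comp X.1
    · change 𝟙 _ ≫ 𝟙 X.2 = 𝟙 _ ≫ 𝟙 _ ≫ 𝟙 _
      simp
  unit_comp X := by
    ext
    · exact (MndHom.counitHom S).unit_comp X.1
    · change 𝟙 _ ≫ 𝟙 X.2 = 𝟙 X.2
      simp

/-- The identification of the monad of `Q × F^S ⊣ Q × U^S` with `1 × S`. -/
def MndHom.freeProdHom (S : Monad C) (Q : Type u₅) [Category.{v₅} Q] :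
    MndHom (prodAdj (Adjunction.id (C := Q)) S.adj).toMonad (prodMonad (Monad.id Q) S) where
  functor := 𝟭 (Q × C)
  ψ := { app := fun X => 𝟙 ((X.1, S.obj X.2) : Q × C)
         naturality := fun X X' h => by
          ext
          · change h.1 ≫ 𝟙 _ = 𝟙 _ ≫ h.1
            simp
          · change S.map h.2 ≫ 𝟙 _ = 𝟙 _ ≫ S.map h.2
            simp }
  mul_comp X := by
    ext
    · change 𝟙 _ ≫ 𝟙 X.1 = 𝟙 _ ≫ 𝟙 _ ≫ 𝟙 _
      simp
    · exact (MndHom.counitHom S).mul_comp X.2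
  unit_comp X := by
    ext
    · change 𝟙 _ ≫ 𝟙 X.1 = 𝟙 X.1
      simp
    · exact (MndHom.counitHom S).unit_comp X.2

/-- The hom-isomorphism of `Φ ⊣ Ψ` on 1-cells, from `Mnd(Cat)` to `Adj_R(Cat)`: apply `Ψ` and
precompose with the unit. -/
def toAdjTranspose {L : C ⥤ X} {R : X ⥤ C} {a : L ⊣ R} (φ : MndHom a.toMonad T) :
    AdjHom a T.adj :=
  (comparisonHom a).comp φ.toAdjHom

/-- The hom-isomorphism of `Φ ⊣ Ψ` on 1-cells, from `Adj_R(Cat)` to `Mnd(Cat)`: apply `Φ` and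
postcompose with the counit. -/
noncomputable def toMndTranspose {L : C ⥤ X} {R : X ⥤ C} {a : L ⊣ R} (f : AdjHom a T.adj) :
    MndHom a.toMonad T :=
  f.toMndHom.comp (MndHom.counitHom T)

end

section
variable {S : Monad C} {T : Monad D} {E : Monad P}

/-- The component of `ψ` at `(c, m)`. -/
def MndHom.app₂ (f : MndHom (prodMonad S E) T) (c : C) (m : P) :
    T.obj (f.functor.obj (c, m)) ⟶ f.functor.obj (S.obj c, E.obj m) :=
  f.ψ.app (c, m)

lemma MndHom.app₂_naturality (f : MndHom (prodMonad S E) T) {c c' : C} {m m' : P}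
    (h : c ⟶ c') (k : m ⟶ m') :
    T.map (f.functor.map (h ×ₘ k)) ≫ f.app₂ c' m' =
      f.app₂ c m ≫ f.functor.map (S.map h ×ₘ E.map k) :=
  f.ψ.naturality (h ×ₘ k)

lemma MndHom.app₂_mul (f : MndHom (prodMonad S E) T) (c : C) (m : P) :
    T.μ.app (f.functor.obj (c, m)) ≫ f.app₂ c m =
      T.map (f.app₂ c m) ≫ f.app₂ (S.obj c) (E.obj m) ≫
        f.functor.map (S.μ.app c ×ₘ E.μ.app m) :=
  f.mul_comp (c, m)

lemma MndHom.app₂_unit (f : MndHom (prodMonad S E) T) (c : C) (m : P) :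
    T.η.app (f.functor.obj (c, m)) ≫ f.app₂ c m = f.functor.map (S.η.app c ×ₘ E.η.app m) :=
  f.unit_comp (c, m)

lemma MndHom.app₂_naturality_assoc (f : MndHom (prodMonad S E) T) {c c' : C} {m m' : P}
    (h : c ⟶ c') (k : m ⟶ m') {Z : D} (z : f.functor.obj (S.obj c', E.obj m') ⟶ Z) :
    T.map (f.functor.map (h ×ₘ k)) ≫ f.app₂ c' m' ≫ z =
      f.app₂ c m ≫ f.functor.map (S.map h ×ₘ E.map k) ≫ z := by
  rw [← Category.assoc, f.app₂_naturality, Category.assoc]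

lemma MndHom.app₂_mul_assoc (f : MndHom (prodMonad S E) T) (c : C) (m : P) {Z : D}
    (z : f.functor.obj (S.obj c, E.obj m) ⟶ Z) :
    T.μ.app (f.functor.obj (c, m)) ≫ f.app₂ c m ≫ z =
      T.map (f.app₂ c m) ≫ f.app₂ (S.obj c) (E.obj m) ≫
        f.functor.map (S.μ.app c ×ₘ E.μ.app m) ≫ z := by
  rw [← Category.assoc, f.app₂_mul, Category.assoc, Category.assoc]

lemma MndHom.app₂_unit_assoc (f : MndHom (prodMonad S E) T) (c : C) (m : P) {Z : D}
    (z : f.functor.obj (S.obj c, E.obj m) ⟶ Z) :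
    T.η.app (f.functor.obj (c, m)) ≫ f.app₂ c m ≫ z =
      f.functor.map (S.η.app c ×ₘ E.η.app m) ≫ z := by
  rw [← Category.assoc, f.app₂_unit]

/-- The component of the left Hopf operator at an object `c` and an algebra `(M, k)`:
`J (S c, k) ∘ ψ (c, M) : T J (c, M) ⟶ J (S c, M)`. -/
def MndHom.hopfApp (f : MndHom (prodMonad S E) T) (c : C) (M : E.Algebra) :
    T.obj (f.functor.obj (c, M.A)) ⟶ f.functor.obj (S.obj c, M.A) :=
  f.app₂ c M.A ≫ f.functor.map (𝟙 (S.obj c) ×ₘ M.a)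

lemma MndHom.hopfApp_naturality (f : MndHom (prodMonad S E) T) {c c' : C} {M M' : E.Algebra}
    (h : c ⟶ c') (k : M ⟶ M') :
    T.map (f.functor.map (h ×ₘ k.f)) ≫ f.hopfApp c' M' =
      f.hopfApp c M ≫ f.functor.map (S.map h ×ₘ k.f) := by
  simp [MndHom.hopfApp, MndHom.app₂_naturality_assoc, ← Functor.map_comp]

lemma MndHom.hopfApp_mul (f : MndHom (prodMonad S E) T) (c : C) (M : E.Algebra) :
    T.μ.app (f.functor.obj (c, M.A)) ≫ f.hopfApp c M =
      T.map (f.hopfApp c M) ≫ f.hopfApp (S.obj c) M ≫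
        f.functor.map (S.μ.app c ×ₘ 𝟙 M.A) := by
  simp [MndHom.hopfApp, MndHom.app₂_naturality_assoc, MndHom.app₂_mul_assoc,
    ← f.functor.map_comp, M.assoc]

lemma MndHom.hopfApp_unit (f : MndHom (prodMonad S E) T) (c : C) (M : E.Algebra) :
    T.η.app (f.functor.obj (c, M.A)) ≫ f.hopfApp c M =
      f.functor.map (S.η.app c ×ₘ 𝟙 M.A) := by
  simp [MndHom.hopfApp, MndHom.app₂_unit_assoc, ← Functor.map_comp, M.unit]

/-- For a 1-cell `(J, ψ) : (C × P, S × E) ⟶ (D, T)`, the 1-cell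
`(J (C × U^E), H(ψ)) : (C × P^E, S × 1) ⟶ (D, T)` given by the left Hopf operator `H(ψ)`. -/
def MndHom.hopfOp (f : MndHom (prodMonad S E) T) :
    MndHom (prodMonad S (Monad.id E.Algebra)) T where
  functor := (𝟭 C).prod E.forget ⋙ f.functor
  ψ := { app := fun X => f.hopfApp X.1 X.2
         naturality := fun _ _ h => f.hopfApp_naturality h.1 h.2 }
  mul_comp X := f.hopfApp_mul X.1 X.2
  unit_comp X := f.hopfApp_unit X.1 X.2

/-- The 1-cell `(J, ψ)` is left Hopf: its left Hopf operator `H(ψ)` is invertible. -/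
def MndHom.IsLeftHopf (f : MndHom (prodMonad S E) T) : Prop := IsIso f.hopfOp.ψ

/-- For invertible `ψ : T J ⟶ J S` and `J ⊣ G`, the mate `ad(ψ) : S G ⟶ G T` of `ψ⁻¹ : J S ⟶ T J`. -/
noncomputable def MndHom.adψ (f : MndHom S T) [IsIso f.ψ] {G : D ⥤ C} (adj : f.functor ⊣ G) :
    G ⋙ S.toFunctor ⟶ T.toFunctor ⋙ G :=
  (mateEquiv adj adj
    (TwoSquare.mk S.toFunctor f.functor f.functor T.toFunctor (inv f.ψ))).natTrans

/-- The component of `ψ⁻¹`. -/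
noncomputable def MndHom.invApp (f : MndHom S T) [IsIso f.ψ] (c : C) :
    f.functor.obj (S.obj c) ⟶ T.obj (f.functor.obj c) :=
  (inv f.ψ).app c

/-- The component of `ψ`. -/
def MndHom.app (f : MndHom S T) (c : C) :
    T.obj (f.functor.obj c) ⟶ f.functor.obj (S.obj c) :=
  f.ψ.app c

lemma MndHom.app_invApp (f : MndHom S T) [IsIso f.ψ] (c : C) :
    f.app c ≫ f.invApp c = 𝟙 _ := by
  have h := congrArg (fun x => x.app c) (IsIso.hom_inv_id f.ψ)
  exact h

lemma MndHom.invApp_app (f : MndHom S T) [IsIso f.ψ] (c : C) :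
    f.invApp c ≫ f.app c = 𝟙 _ := by
  have h := congrArg (fun x => x.app c) (IsIso.inv_hom_id f.ψ)
  exact h

lemma MndHom.invApp_naturality (f : MndHom S T) [IsIso f.ψ] {c c' : C} (h : c ⟶ c') :
    f.functor.map (S.map h) ≫ f.invApp c' = f.invApp c ≫ T.map (f.functor.map h) :=
  (inv f.ψ).naturality h

lemma MndHom.invApp_mul (f : MndHom S T) [IsIso f.ψ] (c : C) :
    f.functor.map (S.μ.app c) ≫ f.invApp c =
      f.invApp (S.obj c) ≫ T.map (f.invApp c) ≫ T.μ.app (f.functor.obj c) := by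
  have h : T.μ.app (f.functor.obj c) ≫ f.app c =
    T.map (f.app c) ≫ f.app (S.obj c) ≫ f.functor.map (S.μ.app c) := f.mul_comp c
  have h' := congrArg (fun x => f.invApp (S.obj c) ≫ T.map (f.invApp c) ≫ x ≫ f.invApp c) h
  simp only [Category.assoc, app_invApp, Category.comp_id] at h'
  rw [← T.map_comp_assoc, invApp_app, CategoryTheory.Functor.map_id, Category.id_comp,
    reassoc_of% (f.invApp_app (S.obj c))] at h'
  rw [← h']

lemma MndHom.invApp_unit (f : MndHom S T) [IsIso f.ψ] (c : C) :
    f.functor.map (S.η.app c) ≫ f.invApp c = T.η.app (f.functor.obj c) := by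
  have h : T.η.app (f.functor.obj c) ≫ f.app c = f.functor.map (S.η.app c) := f.unit_comp c
  rw [← h, Category.assoc, app_invApp]
  exact Category.comp_id _

/-- The component of `ad(ψ)`. -/
noncomputable def MndHom.adApp (f : MndHom S T) [IsIso f.ψ] {G : D ⥤ C} (adj : f.functor ⊣ G)
    (d : D) : S.obj (G.obj d) ⟶ G.obj (T.obj d) :=
  (f.adψ adj).app d

lemma MndHom.map_adApp_counit (f : MndHom S T) [IsIso f.ψ] {G : D ⥤ C} (adj : f.functor ⊣ G)
    (d : D) : f.functor.map (f.adApp adj d) ≫ adj.counit.app (T.obj d) =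
      f.invApp (G.obj d) ≫ T.map (adj.counit.app d) :=
  mateEquiv_counit adj adj
    (TwoSquare.mk S.toFunctor f.functor f.functor T.toFunctor (inv f.ψ)) d

lemma MndHom.adApp_mul (f : MndHom S T) [IsIso f.ψ] {G : D ⥤ C} (adj : f.functor ⊣ G)
    (d : D) : S.μ.app (G.obj d) ≫ f.adApp adj d =
      S.map (f.adApp adj d) ≫ f.adApp adj (T.obj d) ≫ G.map (T.μ.app d) := by
  apply (adj.homEquiv _ _).symm.injective
  have h5 : f.functor.map (G.map (T.μ.app d)) ≫ adj.counit.app (T.obj d) =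
      adj.counit.app (T.obj (T.obj d)) ≫ T.μ.app d := adj.counit.naturality (T.μ.app d)
  have h6 : T.map (T.map (adj.counit.app d)) ≫ T.μ.app d =
    T.μ.app (f.functor.obj (G.obj d)) ≫ T.map (adj.counit.app d) :=
      T.μ.naturality (adj.counit.app d)
  simp only [Adjunction.homEquiv_counit, Functor.map_comp, Category.assoc]
  rw [map_adApp_counit, h5, reassoc_of% (f.map_adApp_counit adj (T.obj d)),
    reassoc_of% (f.invApp_naturality (f.adApp adj d)),
    ← T.map_comp_assoc, map_adApp_counit, reassoc_of% (f.invApp_mul (G.obj d)), ← h6]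
  simp only [Functor.map_comp, Category.assoc]

lemma MndHom.adApp_unit (f : MndHom S T) [IsIso f.ψ] {G : D ⥤ C} (adj : f.functor ⊣ G)
    (d : D) : S.η.app (G.obj d) ≫ f.adApp adj d = G.map (T.η.app d) := by
  apply (adj.homEquiv _ _).symm.injective
  have h5 : f.functor.map (G.map (T.η.app d)) ≫ adj.counit.app (T.obj d) =
      adj.counit.app d ≫ T.η.app d := adj.counit.naturality (T.η.app d)
  have h6 : adj.counit.app d ≫ T.η.app d =
    T.η.app (f.functor.obj (G.obj d)) ≫ T.map (adj.counit.app d) :=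
      T.η.naturality (adj.counit.app d)
  simp only [Adjunction.homEquiv_counit, Functor.map_comp, Category.assoc]
  rw [map_adApp_counit, h5, h6, ← Category.assoc]
  exact congrArg (· ≫ T.map (adj.counit.app d)) (f.invApp_unit (G.obj d))

instance (f : MndHom (prodMonad S (Monad.id Q)) T) [IsIso f.ψ] (q : Q) : IsIso (f.atSnd q).ψ := by
  have : ∀ c, IsIso ((f.atSnd q).ψ.app c) := fun c =>
    inferInstanceAs (IsIso (f.ψ.app (c, q)))
  exact NatIso.isIso_of_isIso_app _

lemma inv_swap_aux {A B A' B' : D} (t : A ⟶ A') (u : B ⟶ B') (p : A ⟶ B) (p' : A' ⟶ B')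
    (i : B ⟶ A) (i' : B' ⟶ A') (h : t ≫ p' = p ≫ u) (e1 : p' ≫ i' = 𝟙 A') (e2 : i ≫ p = 𝟙 B) :
    u ≫ i' = i ≫ t := by
  have h' := congrArg (fun x => i ≫ x ≫ i') h
  simp only [Category.assoc, e1, reassoc_of% e2, Category.comp_id] at h'
  exact h'.symm

lemma ad_naturality_aux (F : C × Q ⥤ D) (G : Qᵒᵖ × D ⥤ C) (S : C ⥤ C) (T : D ⥤ D)
    (z : ∀ (q : Q) (c : C), F.obj (S.obj c, q) ⟶ T.obj (F.obj (c, q)))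
    (w : ∀ (q : Q) (d : D), S.obj (G.obj (op q, d)) ⟶ G.obj (op q, T.obj d))
    (ev : ∀ (q : Q) (d : D), F.obj (G.obj (op q, d), q) ⟶ d)
    (hw : ∀ q d, F.map (w q d ×ₘ 𝟙 q) ≫ ev q (T.obj d) =
      z q (G.obj (op q, d)) ≫ T.map (ev q d))
    {q q' : Q} (h : q' ⟶ q) {d d' : D} (k : d ⟶ d')
    (hev : ∀ {e e' : D} (l : e ⟶ e'), F.map (G.map (h.op ×ₘ l) ×ₘ 𝟙 q') ≫ ev q' e' =
      F.map (𝟙 _ ×ₘ h) ≫ ev q e ≫ l)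
    (hz : ∀ c, F.map (𝟙 (S.obj c) ×ₘ h) ≫ z q c = z q' c ≫ T.map (F.map (𝟙 c ×ₘ h)))
    (hz' : ∀ {c c' : C} (x : c ⟶ c'), F.map (S.map x ×ₘ 𝟙 q') ≫ z q' c' =
      z q' c ≫ T.map (F.map (x ×ₘ 𝟙 q'))) :
    F.map ((S.map (G.map (h.op ×ₘ k)) ≫ w q' d') ×ₘ 𝟙 q') ≫ ev q' (T.obj d') =
      F.map ((w q d ≫ G.map (h.op ×ₘ T.map k)) ×ₘ 𝟙 q') ≫ ev q' (T.obj d') := by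
  have e1 : F.map ((S.map (G.map (h.op ×ₘ k)) ≫ w q' d') ×ₘ 𝟙 q') =
      F.map (S.map (G.map (h.op ×ₘ k)) ×ₘ 𝟙 q') ≫ F.map (w q' d' ×ₘ 𝟙 q') := by
    rw [← F.map_comp]
    exact congrArg F.map (Prod.hom_ext rfl (Category.comp_id _).symm)
  have e2 : F.map ((w q d ≫ G.map (h.op ×ₘ T.map k)) ×ₘ 𝟙 q') =
      F.map (w q d ×ₘ 𝟙 q') ≫ F.map (G.map (h.op ×ₘ T.map k) ×ₘ 𝟙 q') := by
    rw [← F.map_comp]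
    exact congrArg F.map (Prod.hom_ext rfl (Category.comp_id _).symm)
  have e3 : F.map (w q d ×ₘ 𝟙 q') ≫ F.map (𝟙 (G.obj (op q, T.obj d)) ×ₘ h) =
      F.map (𝟙 _ ×ₘ h) ≫ F.map (w q d ×ₘ 𝟙 q) := by
    simp [← F.map_comp]
  rw [e1, e2, Category.assoc, Category.assoc, hw, hev, reassoc_of% e3, reassoc_of% (hw q d),
    reassoc_of% (hz (G.obj (op q, d))), reassoc_of% (hz' (G.map (h.op ×ₘ k))), ← T.map_comp,
    hev, T.map_comp, T.map_comp]

lemma MndHom.adParam_naturality (f : MndHom (prodMonad S (Monad.id Q)) T) [IsIso f.ψ]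
    {G : Qᵒᵖ × D ⥤ C} (adj : (curry.obj f.functor).flip ⊣₂ curry.obj G) {q q' : Q} (h : q' ⟶ q)
    {d d' : D} (k : d ⟶ d') :
    S.map (G.map (h.op ×ₘ k)) ≫ (f.atSnd q').adApp (adj.adj q') d' =
      (f.atSnd q).adApp (adj.adj q) d ≫ G.map (h.op ×ₘ T.map k) := by
  apply ((adj.adj q').homEquiv _ _).symm.injective
  rw [Adjunction.homEquiv_counit, Adjunction.homEquiv_counit]
  refine ad_naturality_aux f.functor G S.toFunctor T.toFunctor
    (fun q c => (f.atSnd q).invApp c) (fun q d => (f.atSnd q).adApp (adj.adj q) d)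
    (fun q d => (adj.adj q).counit.app d)
    (fun q d => (f.atSnd q).map_adApp_counit (adj.adj q) d) h k ?_ ?_ ?_
  · intro e e' l
    have h1 : f.functor.map (𝟙 (G.obj (op q, e)) ×ₘ h) ≫ (adj.adj q).counit.app e =
        f.functor.map (G.map (h.op ×ₘ 𝟙 e) ×ₘ 𝟙 q') ≫ (adj.adj q').counit.app e :=
      congrArg (fun x => x.app e) (adj.whiskerLeft_map_counit h)
    have h2 : f.functor.map (G.map (𝟙 (op q') ×ₘ l) ×ₘ 𝟙 q') ≫ (adj.adj q').counit.app e' =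
        (adj.adj q').counit.app e ≫ l := (adj.adj q').counit.naturality l
    have h3 : f.functor.map (G.map (h.op ×ₘ l) ×ₘ 𝟙 q') =
        f.functor.map (G.map (h.op ×ₘ 𝟙 e) ×ₘ 𝟙 q') ≫
          f.functor.map (G.map (𝟙 (op q') ×ₘ l) ×ₘ 𝟙 q') := by
      simp [← Functor.map_comp]
    rw [h3, ← Category.assoc]
    refine Eq.trans ?_ (congrArg (· ≫ l) h1.symm)
    rw [Category.assoc, Category.assoc]
    exact congrArg (fun x => f.functor.map (G.map (h.op ×ₘ 𝟙 e) ×ₘ 𝟙 q') ≫ x) h2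
  · intro c
    have h1 : T.map (f.functor.map (𝟙 c ×ₘ h)) ≫ f.app₂ c q =
        f.app₂ c q' ≫ f.functor.map (S.map (𝟙 c) ×ₘ h) := f.app₂_naturality (𝟙 c) h
    rw [CategoryTheory.Functor.map_id] at h1
    have e1 : f.app₂ c q ≫ (f.atSnd q).invApp c = 𝟙 (T.obj (f.functor.obj (c, q))) :=
      (f.atSnd q).app_invApp c
    have e2 : (f.atSnd q').invApp c ≫ f.app₂ c q' = 𝟙 (f.functor.obj (S.obj c, q')) :=
      (f.atSnd q').invApp_app c
    exact inv_swap_aux _ _ _ _ _ _ h1 e1 e2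
  · intro c c' x
    exact (f.atSnd q').invApp_naturality x

/-- For a 1-cell `(J, ψ) : (C × Q, S × 1) ⟶ (D, T)` with `ψ` invertible and a parametric adjunction
`J ⊣_Q G`, the 1-cell `(G, ad(ψ)) : (Qᵒᵖ × D, 1 × T) ⟶ (C, S)` whose component at `(q, d)` is the
component at `d` of `ad(ψ (-, q))`. -/
noncomputable def MndHom.adParam (f : MndHom (prodMonad S (Monad.id Q)) T) [IsIso f.ψ]
    {G : Qᵒᵖ × D ⥤ C} (adj : (curry.obj f.functor).flip ⊣₂ curry.obj G) :
    MndHom (prodMonad (Monad.id Qᵒᵖ) T) S where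
  functor := G
  ψ := { app := fun X => ((f.atSnd X.1.unop).adψ (adj.adj X.1.unop)).app X.2
         naturality := fun _ _ h => f.adParam_naturality adj h.1.unop h.2 }
  mul_comp X := (f.atSnd X.1.unop).adApp_mul (adj.adj X.1.unop) X.2
  unit_comp X := (f.atSnd X.1.unop).adApp_unit (adj.adj X.1.unop) X.2

end

/-- The adjunction `J (-, U q) ⊣ K (U q, -)` of a parametric adjunction `J ⊣_P K`. -/
@[simps! unit_app counit_app]
def restrictAdj {J : C × P ⥤ D} {K : Pᵒᵖ × D ⥤ C}
    (adj : (curry.obj J).flip ⊣₂ curry.obj K) (U : Q ⥤ P) (q : Q) :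
    (curry.obj ((𝟭 C).prod U ⋙ J)).flip.obj q ⊣
      (curry.obj (U.op.prod (𝟭 D) ⋙ K)).obj (op q) where
  unit :=
    { app := fun c => (adj.adj (U.obj q)).unit.app c
      naturality := fun c c' h => by simpa using (adj.adj (U.obj q)).unit.naturality h }
  counit :=
    { app := fun d => (adj.adj (U.obj q)).counit.app d
      naturality := fun d d' h => by simpa using (adj.adj (U.obj q)).counit.naturality h }
  left_triangle_components c := by
    simpa using (adj.adj (U.obj q)).left_triangle_components c
  right_triangle_components d := by
    simpa using (adj.adj (U.obj q)).right_triangle_components d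

/-- The parametric adjunction `J (C × U) ⊣_Q K (Uᵒᵖ × D)` obtained from `J ⊣_P K` along a functor
`U : Q ⥤ P`. -/
def restrictParam {J : C × P ⥤ D} {K : Pᵒᵖ × D ⥤ C}
    (adj : (curry.obj J).flip ⊣₂ curry.obj K) (U : Q ⥤ P) :
    (curry.obj ((𝟭 C).prod U ⋙ J)).flip ⊣₂ curry.obj (U.op.prod (𝟭 D) ⋙ K) where
  adj q := restrictAdj adj U q
  unit_whiskerRight_map h := by
    ext c
    have e := congrArg (fun x => x.app c) (adj.unit_whiskerRight_map (U.map h))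
    simpa using e

end More

/-- A Hopf parametric adjunction over `Q` in `Mnd(Cat)` between the 1-cells
`(J, ψ) : (C × Q, S × 1) ⟶ (D, T)` and `(K, ψ') : (Qᵒᵖ × D, 1 × T) ⟶ (C, S)`: the transformation `ψ`
is invertible, `J ⊣_Q K` is a parametric adjunction, and for every `q` the adjunction
`J (-, q) ⊣ K (q, -)` is an adjunction inside `Mnd(Cat)`. -/
structure MndHopfParamAdj {C : Type u₁} [Category.{v₁} C] {D : Type u₂} [Category.{v₂} D]
    {Q : Type u₃} [Category.{v₃} Q] {S : Monad C} {T : Monad D}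
    (f : MndHom (prodMonad S (Monad.id Q)) T) (g : MndHom (prodMonad (Monad.id Qᵒᵖ) T) S) where
  isIso : IsIso f.ψ
  adj : (curry.obj f.functor).flip ⊣₂ curry.obj g.functor
  isAdjointObject (q : Q) : (f.atSnd q).IsAdjointObject (g.atFst (op q)) (adj.adj q)

/-- A Hopf parametric adjunction over `Q` in `Adj_R(Cat)` between 1-cells `(J, V, λ)`, from
`L × Q ⊣ R × Q` to `L' ⊣ R'`, and `(K, W, λ')`, from `Qᵒᵖ × L' ⊣ Qᵒᵖ × R'` to `L ⊣ R`: the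
transformation `λ` is invertible, `J ⊣_Q K` and `V ⊣_Q W` are parametric adjunctions, and for every
`q` the adjunctions `J (-, q) ⊣ K (q, -)` and `V (-, q) ⊣ W (q, -)` form an adjunction inside
`Adj_R(Cat)`. -/
structure AdjHopfParamAdj {C : Type u₁} [Category.{v₁} C] {D : Type u₂} [Category.{v₂} D]
    {X : Type u₃} [Category.{v₃} X] {Y : Type u₄} [Category.{v₄} Y]
    {Q : Type u₅} [Category.{v₅} Q] {L : C ⥤ X} {R : X ⥤ C} {L' : D ⥤ Y} {R' : Y ⥤ D}
    {a : L ⊣ R} {b : L' ⊣ R'}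
    (f : AdjHom (prodAdj a (Adjunction.id (C := Q))) b)
    (g : AdjHom (prodAdj (Adjunction.id (C := Qᵒᵖ)) b) a) where
  isIso : IsIso f.lam
  adjTop : (curry.obj f.top).flip ⊣₂ curry.obj g.top
  adjBot : (curry.obj f.bot).flip ⊣₂ curry.obj g.bot
  isAdjointObject (q : Q) :
    (f.atSnd q).IsAdjointObject (g.atFst (op q)) (adjTop.adj q) (adjBot.adj q)

section Forms
variable {C : Type u₁} [Category.{v₁} C] {D : Type u₂} [Category.{v₂} D]
  {P : Type u₃} [Category.{v₃} P] {S : Monad C} {T : Monad D} {E : Monad P}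

/-- For a left Hopf 1-cell `(J, ψ)` and a parametric adjunction `J ⊣_P K`, the 1-cell
`(K (U^Eᵒᵖ × D), H♯(ψ)) : ((P^E)ᵒᵖ × D, 1 × T) ⟶ (C, S)` with `H♯(ψ) = ad(H(ψ))`. -/
noncomputable def hopfSharp (f : MndHom (prodMonad S E) T) (hf : f.IsLeftHopf) {K : Pᵒᵖ × D ⥤ C}
    (adj : (curry.obj f.functor).flip ⊣₂ curry.obj K) :
    MndHom (prodMonad (Monad.id E.Algebraᵒᵖ) T) S :=
  haveI : IsIso f.hopfOp.ψ := hf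
  f.hopfOp.adParam (restrictParam adj E.forget)

/-- The 1-cell `(J, J^ψ, λ)` from `F^S × Q ⊣ U^S × Q` to `F^T ⊣ U^T` that corresponds to
`(J, ψ) : (C × Q, S × 1) ⟶ (D, T)` under the hom-isomorphism of `Φ ⊣ Ψ`. -/
noncomputable def liftLeft {Q : Type u₅} [Category.{v₅} Q] (f : MndHom (prodMonad S (Monad.id Q)) T) :
    AdjHom (prodAdj S.adj (Adjunction.id (C := Q))) T.adj :=
  toAdjTranspose ((MndHom.prodFreeHom S Q).comp f)

/-- The 1-cell `(K, K^ψ, λ)` from `Q × F^T ⊣ Q × U^T` to `F^S ⊣ U^S` that corresponds to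
`(K, ψ) : (Q × D, 1 × T) ⟶ (C, S)` under the hom-isomorphism of `Φ ⊣ Ψ`. -/
noncomputable def liftRight {Q : Type u₅} [Category.{v₅} Q] (g : MndHom (prodMonad (Monad.id Q) T) S) :
    AdjHom (prodAdj (Adjunction.id (C := Q)) T.adj) S.adj :=
  toAdjTranspose ((MndHom.freeProdHom T Q).comp g)

end Forms

end HopfParametric

open HopfParametric

/-!
The 2-functor `Ψ` sends a 1-cell of monads to its lift to algebras, and the mate `ρ` of the
resulting transformation `λ` is the identity, because the lift strictly commutes with the forgetful
functors. Two things follow.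

First, `Φ` undoes the transposition (`toMndTranspose_toAdjTranspose`).

Second, in terms of mates (`AdjHom.isTwoCell_iff_rho`), a pair `(α, β)` is a 2-cell between such
1-cells exactly when the morphisms underlying the components of `β` are the components of `α` at the
carriers. Hence an adjunction inside `Adj_R(Cat)` between transposes consists of an adjunction
`J ⊣ K` together with an adjunction between categories of algebras lying strictly over it
(`isAdjointObject_lift_iff`), and the latter is unique if it exists. It exists exactly when the unit
and counit of `J ⊣ K` are morphisms of algebras at every algebra, and evaluating at free algebras
shows that this means that unit and counit are 2-cells of monads (`MndHom.isTwoCell_iff_lift`,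
`mnd_isAdjointObject_iff`). Naturality in the parameter can be tested on underlying morphisms. This
gives the bijection `hopfParamAdjEquiv`.

The restriction of the given parametric adjunction is Hopf by doctrinal adjunction: the structure on
the right adjoint is the mate of the inverse of the structure on the left adjoint
(`MndHom.isAdjointObject_of_adψ`).
-/

namespace HopfParametric

/-! ### Mates of composites and of 2-cells -/

section Mates
variable {C : Type u₁} [Category.{v₁} C] {D : Type u₂} [Category.{v₂} D]
  {X : Type u₃} [Category.{v₃} X] {Y : Type u₄} [Category.{v₄} Y]
  {B : Type u₅} [Category.{v₅} B] {Z : Type u₆} [Category.{v₆} Z]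
  {L : C ⥤ X} {R : X ⥤ C} {L' : D ⥤ Y} {R' : Y ⥤ D} {L'' : B ⥤ Z} {R'' : Z ⥤ B}
  {a : L ⊣ R} {b : L' ⊣ R'} {c : L'' ⊣ R''}

lemma AdjHom.rho_id (x : X) : (AdjHom.id a).rho.app x = 𝟙 (R.obj x) := by
  rw [AdjHom.rho_app]
  change a.unit.app (R.obj x) ≫ R.map (𝟙 _) ≫ R.map (a.counit.app x) = _
  simp

lemma AdjHom.rho_comp (f : AdjHom a b) (g : AdjHom b c) (x : X) :
    (f.comp g).rho.app x = g.top.map (f.rho.app x) ≫ g.rho.app (f.bot.obj x) := by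
  have h1 := g.lam.naturality (f.rho.app x)
  have h2 := c.unit.naturality (g.top.map (f.rho.app x))
  have h3 := f.rho_counit x
  rw [AdjHom.rho_app, AdjHom.rho_app g]
  change c.unit.app (g.top.obj (f.top.obj (R.obj x))) ≫
    R''.map (g.lam.app (f.top.obj (R.obj x)) ≫ g.bot.map (f.lam.app (R.obj x))) ≫
      R''.map (g.bot.map (f.bot.map (a.counit.app x))) = _
  dsimp at h1 h2
  rw [reassoc_of% h2, ← R''.map_comp_assoc, h1, ← R''.map_comp, ← R''.map_comp]
  simp only [Category.assoc, ← g.bot.map_comp, h3]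

/-- A pair `(α, β)` is a 2-cell of `Adj_R(Cat)` if and only if it is compatible with the mates `ρ`
of the transformations `λ`. -/
lemma AdjHom.isTwoCell_iff_rho (f g : AdjHom a b) (α : f.top ⟶ g.top) (β : f.bot ⟶ g.bot) :
    AdjHom.IsTwoCell f g α β ↔
      ∀ x : X, α.app (R.obj x) ≫ g.rho.app x = f.rho.app x ≫ R'.map (β.app x) := by
  constructor
  · intro h x
    have h1 := b.unit.naturality (α.app (R.obj x))
    have h2 := β.naturality (a.counit.app x)
    have h3 := h (R.obj x)
    dsimp at h1 h2
    rw [AdjHom.rho_app, AdjHom.rho_app, reassoc_of% h1]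
    simp only [← R'.map_comp, Category.assoc]
    rw [h2, ← reassoc_of% h3]
  · intro h c
    apply (b.homEquiv _ _).injective
    have h1 := f.unit_lam c
    have h2 := g.unit_lam c
    have h3 := h (L.obj c)
    have h4 := b.unit.naturality (α.app c)
    have h5 := α.naturality (a.unit.app c)
    dsimp at h4 h5
    simp only [Adjunction.homEquiv_unit, Functor.map_comp]
    rw [reassoc_of% h1, ← reassoc_of% h4, h2, ← h3, reassoc_of% h5]

end Mates

/-! ### Transposes under `Φ ⊣ Ψ` -/

section Algebras
variable {C : Type u₁} [Category.{v₁} C] {D : Type u₂} [Category.{v₂} D]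
  {X : Type u₃} [Category.{v₃} X] {Q : Type u₅} [Category.{v₅} Q]
  {S : Monad C} {T : Monad D}

lemma comp_map_id (F : C ⥤ D) {d : D} {c : C} (p : d ⟶ F.obj c) : p ≫ F.map (𝟙 c) = p := by
  simp

lemma comp_map_map (F : C ⥤ D) {d : D} {c c' c'' : C} (p : d ⟶ F.obj c) {u : c ⟶ c'}
    {v : c' ⟶ c''} {w : c ⟶ c''} (h : u ≫ v = w) : (p ≫ F.map u) ≫ F.map v = p ≫ F.map w := by
  rw [Category.assoc, ← F.map_comp, h]

lemma adj_counit_app_f (A : S.Algebra) : (S.adj.counit.app A).f = A.a := by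
  simp
  rfl

/-- Since the functors agree only propositionally in general, the components are compared by
heterogeneous equality. -/
lemma MndHom.ext' {f g : MndHom S T} (h : f.functor = g.functor)
    (h' : ∀ c, HEq (f.ψ.app c) (g.ψ.app c)) : f = g := by
  obtain ⟨F, ψ, _, _⟩ := f
  obtain ⟨G, ψ', _, _⟩ := g
  obtain rfl : F = G := h
  obtain rfl : ψ = ψ' := by
    ext c
    exact eq_of_heq (h' c)
  rfl

/-- The 2-cells `(J, ψ) ⟶ (J', ψ')` of `Mnd(Cat)` are the transformations `J ⟶ J'` that lift to
algebras. The converse is seen on free algebras. -/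
lemma MndHom.isTwoCell_iff_lift (f g : MndHom S T) (θ : f.functor ⟶ g.functor) :
    MndHom.IsTwoCell f g θ ↔ ∀ A : S.Algebra,
      T.map (θ.app A.A) ≫ (g.lift.obj A).a = (f.lift.obj A).a ≫ θ.app A.A := by
  constructor
  · intro h A
    change T.map (θ.app A.A) ≫ g.ψ.app A.A ≫ g.functor.map A.a =
      (f.ψ.app A.A ≫ f.functor.map A.a) ≫ θ.app A.A
    have h1 := θ.naturality A.a
    have h2 := h A.A
    rw [Category.assoc, reassoc_of% h2, h1]
  · intro h c
    have h0 : T.map (θ.app (S.obj c)) ≫ g.ψ.app (S.obj c) ≫ g.functor.map (S.μ.app c) =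
      (f.ψ.app (S.obj c) ≫ f.functor.map (S.μ.app c)) ≫ θ.app (S.obj c) := h (S.free.obj c)
    have key (k : MndHom S T) : T.map (k.functor.map (S.η.app c)) ≫ k.ψ.app (S.obj c) ≫
        k.functor.map (S.μ.app c) = k.ψ.app c := by
      have h1 := k.ψ.naturality (S.η.app c)
      dsimp at h1
      rw [reassoc_of% h1, ← k.functor.map_comp, S.right_unit]
      simp
    have h2 := θ.naturality (S.η.app c)
    dsimp at h2
    rw [← key g, ← key f, ← T.map_comp_assoc, ← h2, T.map_comp_assoc, h0]
    simp only [Category.assoc]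

section
variable {L : C ⥤ X} {R : X ⥤ C} {a : L ⊣ R}

/-- The transformation `λ` in the transpose of `φ` has components those of `φ.ψ`. -/
lemma toAdjTranspose_lam_app_f (φ : MndHom a.toMonad T) (c : C) :
    ((toAdjTranspose φ).lam.app c).f = φ.ψ.app c :=
  comp_map_id φ.functor (φ.ψ.app c)

/-- The mate of the transformation in the transpose of `φ` is the identity. -/
lemma toAdjTranspose_rho (φ : MndHom a.toMonad T) (x : X) :
    (toAdjTranspose φ).rho.app x = 𝟙 (φ.functor.obj (R.obj x)) := by
  rw [AdjHom.rho_app]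
  have e : T.adj.unit.app (φ.functor.obj (R.obj x)) = T.η.app (φ.functor.obj (R.obj x)) := by
    simp
    rfl
  have h : T.η.app (φ.functor.obj (R.obj x)) ≫ φ.ψ.app (R.obj x) ≫
      φ.functor.map (R.map (a.counit.app x)) = 𝟙 (φ.functor.obj (R.obj x)) :=
    φ.lift_unit ((Monad.comparison a).obj x)
  change T.adj.unit.app (φ.functor.obj (R.obj x)) ≫ ((toAdjTranspose φ).lam.app (R.obj x)).f ≫
    φ.functor.map (R.map (a.counit.app x)) = 𝟙 (φ.functor.obj (R.obj x))
  rw [e, toAdjTranspose_lam_app_f]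
  exact h

/-- The two hom-isomorphisms of `Φ ⊣ Ψ` compose to the identity on 1-cells of `Mnd(Cat)`: the mate
of a transpose is the identity, so that `Φ` returns the underlying components of `λ`. -/
lemma toMndTranspose_toAdjTranspose (φ : MndHom a.toMonad T) :
    toMndTranspose (toAdjTranspose φ) = φ := by
  refine MndHom.ext' rfl fun c => heq_of_eq ?_
  change 𝟙 (T.obj (φ.functor.obj c)) ≫ ((toAdjTranspose φ).lam.app c).f ≫
    (inv (toAdjTranspose φ).rho).app (L.obj c) = φ.ψ.app c
  have h : (inv (toAdjTranspose φ).rho).app (L.obj c) = 𝟙 (φ.functor.obj (R.obj (L.obj c))) := by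
    have h1 := congrArg (fun x => x.app (L.obj c)) (IsIso.inv_hom_id (toAdjTranspose φ).rho)
    dsimp at h1
    rw [toAdjTranspose_rho] at h1
    exact (Category.comp_id _).symm.trans h1
  rw [h, toAdjTranspose_lam_app_f]
  exact (Category.id_comp _).trans (Category.comp_id _)

lemma toAdjTranspose_isIso_lam (φ : MndHom a.toMonad T) [IsIso φ.ψ] :
    IsIso (toAdjTranspose φ).lam := by
  have h (c : C) : IsIso ((toAdjTranspose φ).lam.app c) := by
    have : IsIso (T.forget.map ((toAdjTranspose φ).lam.app c)) := by
      change IsIso ((toAdjTranspose φ).lam.app c).f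
      rw [toAdjTranspose_lam_app_f]
      exact inferInstanceAs (IsIso (φ.ψ.app c))
    exact isIso_of_reflects_iso _ T.forget
  exact NatIso.isIso_of_isIso_app _

end

lemma liftLeft_rho (f : MndHom (prodMonad S (Monad.id Q)) T) (q : Q) (A : S.Algebra) :
    ((liftLeft f).atSnd q).rho.app A = 𝟙 (f.functor.obj (A.A, q)) := by
  rw [AdjHom.rho_app]
  exact (AdjHom.rho_app (liftLeft f) (A, q)).symm.trans (toAdjTranspose_rho _ _)

lemma liftRight_rho (g : MndHom (prodMonad (Monad.id Q) T) S) (q : Q) (B : T.Algebra) :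
    ((liftRight g).atFst q).rho.app B = 𝟙 (g.functor.obj (q, B.A)) := by
  rw [AdjHom.rho_app]
  exact (AdjHom.rho_app (liftRight g) (q, B)).symm.trans (toAdjTranspose_rho _ _)

lemma liftLeft_obj_a (f : MndHom (prodMonad S (Monad.id Q)) T) (A : S.Algebra) (q : Q) :
    ((liftLeft f).bot.obj (A, q)).a = f.ψ.app (A.A, q) ≫ f.functor.map (A.a ×ₘ 𝟙 q) := by
  change (f.ψ.app (A.A, q) ≫ f.functor.map (𝟙 ((S.obj A.A, q) : C × Q))) ≫
    f.functor.map ((S.adj.counit.app A).f ×ₘ 𝟙 q) = _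
  rw [adj_counit_app_f]
  exact congrArg (· ≫ f.functor.map (A.a ×ₘ 𝟙 q)) (comp_map_id f.functor (f.ψ.app (A.A, q)))

lemma liftRight_obj_a (g : MndHom (prodMonad (Monad.id Q) T) S) (B : T.Algebra) (q : Q) :
    ((liftRight g).bot.obj (q, B)).a = g.ψ.app (q, B.A) ≫ g.functor.map (𝟙 q ×ₘ B.a) := by
  change (g.ψ.app (q, B.A) ≫ g.functor.map (𝟙 ((q, T.obj B.A) : Q × D))) ≫
    g.functor.map (𝟙 q ×ₘ (T.adj.counit.app B).f) = _
  rw [adj_counit_app_f]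
  exact congrArg (· ≫ g.functor.map (𝟙 q ×ₘ B.a)) (comp_map_id g.functor (g.ψ.app (q, B.A)))

end Algebras

/-! ### Lifting parametric adjunctions to algebras -/

section Lifting
variable {C : Type u₁} [Category.{v₁} C] {D : Type u₂} [Category.{v₂} D]
  {Q : Type u₅} [Category.{v₅} Q] {S : Monad C} {T : Monad D}
  {f : MndHom (prodMonad S (Monad.id Q)) T} {g : MndHom (prodMonad (Monad.id Qᵒᵖ) T) S}

/-- Since the mates `ρ` of the transposes are identities, adjunctions `J ⊣ K` and `V ⊣ W` form an
adjunction inside `Adj_R(Cat)` if and only if the latter lies over the former. -/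
lemma isAdjointObject_lift_iff (q : Q)
    (adjTop : ((liftLeft f).atSnd q).top ⊣ ((liftRight g).atFst (op q)).top)
    (adjBot : ((liftLeft f).atSnd q).bot ⊣ ((liftRight g).atFst (op q)).bot) :
    ((liftLeft f).atSnd q).IsAdjointObject ((liftRight g).atFst (op q)) adjTop adjBot ↔
      (∀ A : S.Algebra, (adjBot.unit.app A).f = adjTop.unit.app A.A) ∧
      (∀ B : T.Algebra, (adjBot.counit.app B).f = adjTop.counit.app B.A) := by
  have hu (A : S.Algebra) : (((liftLeft f).atSnd q).comp ((liftRight g).atFst (op q))).rho.app A =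
      𝟙 (g.functor.obj (op q, f.functor.obj (A.A, q))) := by
    rw [AdjHom.rho_comp, liftLeft_rho, liftRight_rho]
    exact (Category.comp_id _).trans (g.functor.map_id (op q, f.functor.obj (A.A, q)))
  have hc (B : T.Algebra) : (((liftRight g).atFst (op q)).comp ((liftLeft f).atSnd q)).rho.app B =
      𝟙 (f.functor.obj (g.functor.obj (op q, B.A), q)) := by
    rw [AdjHom.rho_comp, liftLeft_rho, liftRight_rho]
    exact (Category.comp_id _).trans (f.functor.map_id (g.functor.obj (op q, B.A), q))
  have hu' : AdjHom.IsTwoCell (AdjHom.id S.adj)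
      (((liftLeft f).atSnd q).comp ((liftRight g).atFst (op q))) adjTop.unit adjBot.unit ↔
      ∀ A : S.Algebra, (adjBot.unit.app A).f = adjTop.unit.app A.A := by
    refine (AdjHom.isTwoCell_iff_rho _ _ _ _).trans (forall_congr' fun A => ?_)
    rw [hu, AdjHom.rho_id]
    exact ⟨fun h => ((Category.comp_id _).symm.trans (h.trans (Category.id_comp _))).symm,
      fun h => (Category.comp_id _).trans (h.symm.trans (Category.id_comp _).symm)⟩
  have hc' : AdjHom.IsTwoCell (((liftRight g).atFst (op q)).comp ((liftLeft f).atSnd q))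
      (AdjHom.id T.adj) adjTop.counit adjBot.counit ↔
      ∀ B : T.Algebra, (adjBot.counit.app B).f = adjTop.counit.app B.A := by
    refine (AdjHom.isTwoCell_iff_rho _ _ _ _).trans (forall_congr' fun B => ?_)
    rw [hc, AdjHom.rho_id]
    exact ⟨fun h => ((Category.comp_id _).symm.trans (h.trans (Category.id_comp _))).symm,
      fun h => (Category.comp_id _).trans (h.symm.trans (Category.id_comp _).symm)⟩
  exact ⟨fun h => ⟨hu'.1 h.unit, hc'.1 h.counit⟩, fun h => ⟨hu'.2 h.1, hc'.2 h.2⟩⟩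

/-- An adjunction `J (-, q) ⊣ K (q, -)` lies inside `Mnd(Cat)` if and only if the components of its
unit and counit at algebras are morphisms of algebras. -/
lemma mnd_isAdjointObject_iff (q : Q)
    (adj : (f.atSnd q).functor ⊣ (g.atFst (op q)).functor) :
    (f.atSnd q).IsAdjointObject (g.atFst (op q)) adj ↔
      (∀ A : S.Algebra, S.map (adj.unit.app A.A) ≫
        ((liftRight g).bot.obj (op q, (liftLeft f).bot.obj (A, q))).a =
          A.a ≫ adj.unit.app A.A) ∧
      (∀ B : T.Algebra, T.map (adj.counit.app B.A) ≫ B.a =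
        ((liftLeft f).bot.obj ((liftRight g).bot.obj (op q, B), q)).a ≫ adj.counit.app B.A) := by
  have hu (A : S.Algebra) : (((f.atSnd q).comp (g.atFst (op q))).lift.obj A).a =
      ((liftRight g).bot.obj (op q, (liftLeft f).bot.obj (A, q))).a := by
    rw [liftRight_obj_a, liftLeft_obj_a]
    exact comp_map_map g.functor (g.ψ.app (op q, f.functor.obj (A.A, q)))
      (u := 𝟙 (op q) ×ₘ f.ψ.app (A.A, q)) (v := 𝟙 (op q) ×ₘ f.functor.map (A.a ×ₘ 𝟙 q))
      (Prod.hom_ext (Category.comp_id _) rfl)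
  have hc (B : T.Algebra) : (((g.atFst (op q)).comp (f.atSnd q)).lift.obj B).a =
      ((liftLeft f).bot.obj ((liftRight g).bot.obj (op q, B), q)).a := by
    rw [liftLeft_obj_a, liftRight_obj_a]
    exact comp_map_map f.functor (f.ψ.app (g.functor.obj (op q, B.A), q))
      (u := g.ψ.app (op q, B.A) ×ₘ 𝟙 q) (v := g.functor.map (𝟙 (op q) ×ₘ B.a) ×ₘ 𝟙 q)
      (Prod.hom_ext rfl (Category.comp_id _))
  have hu' : MndHom.IsTwoCell (MndHom.id S) ((f.atSnd q).comp (g.atFst (op q))) adj.unit ↔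
      ∀ A : S.Algebra, S.map (adj.unit.app A.A) ≫
        ((liftRight g).bot.obj (op q, (liftLeft f).bot.obj (A, q))).a =
          A.a ≫ adj.unit.app A.A := by
    refine (MndHom.isTwoCell_iff_lift _ _ _).trans (forall_congr' fun A => ?_)
    have e : ((MndHom.id S).lift.obj A).a = A.a := Category.id_comp A.a
    rw [hu, e]
    rfl
  have hc' : MndHom.IsTwoCell ((g.atFst (op q)).comp (f.atSnd q)) (MndHom.id T) adj.counit ↔
      ∀ B : T.Algebra, T.map (adj.counit.app B.A) ≫ B.a =
        ((liftLeft f).bot.obj ((liftRight g).bot.obj (op q, B), q)).a ≫ adj.counit.app B.A := by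
    refine (MndHom.isTwoCell_iff_lift _ _ _).trans (forall_congr' fun B => ?_)
    have e : ((MndHom.id T).lift.obj B).a = B.a := Category.id_comp B.a
    rw [hc, e]
    rfl
  exact ⟨fun h => ⟨hu'.1 h.unit, hc'.1 h.counit⟩, fun h => ⟨hu'.2 h.1, hc'.2 h.2⟩⟩

/-- The adjunction between categories of algebras that lies over an adjunction
`J (-, q) ⊣ K (q, -)` inside `Mnd(Cat)`. -/
def liftAdj (q : Q) (adj : (f.atSnd q).functor ⊣ (g.atFst (op q)).functor)
    (h : (f.atSnd q).IsAdjointObject (g.atFst (op q)) adj) :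
    (curry.obj (liftLeft f).bot).flip.obj q ⊣ (curry.obj (liftRight g).bot).obj (op q) where
  unit :=
    { app := fun A =>
        { f := adj.unit.app A.A
          h := ((mnd_isAdjointObject_iff q adj).1 h).1 A }
      naturality := fun _ _ k => Monad.Algebra.Hom.ext (adj.unit.naturality k.f) }
  counit :=
    { app := fun B =>
        { f := adj.counit.app B.A
          h := ((mnd_isAdjointObject_iff q adj).1 h).2 B }
      naturality := fun _ _ k => Monad.Algebra.Hom.ext (adj.counit.naturality k.f) }
  left_triangle_components A := Monad.Algebra.Hom.ext (adj.left_triangle_components A.A)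
  right_triangle_components B := Monad.Algebra.Hom.ext (adj.right_triangle_components B.A)

/-- The parametric adjunction between categories of algebras that lies over a Hopf parametric
adjunction in `Mnd(Cat)`. -/
def liftParam (y : MndHopfParamAdj f g) :
    (curry.obj (liftLeft f).bot).flip ⊣₂ curry.obj (liftRight g).bot where
  adj q := liftAdj q (y.adj.adj q) (y.isAdjointObject q)
  unit_whiskerRight_map h := by
    ext A
    exact congrArg (fun x => x.app A.A) (y.adj.unit_whiskerRight_map h)

lemma parametrizedAdjunction_ext {C₁ : Type u₁} {C₂ : Type u₂} {C₃ : Type u₃}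
    [Category.{v₁} C₁] [Category.{v₂} C₂] [Category.{v₃} C₃]
    {F : C₁ ⥤ C₂ ⥤ C₃} {G : C₁ᵒᵖ ⥤ C₃ ⥤ C₂} {a b : F ⊣₂ G}
    (h : ∀ q c, (a.adj q).unit.app c = (b.adj q).unit.app c) : a = b := by
  obtain ⟨a, _⟩ := a
  obtain ⟨b, _⟩ := b
  obtain rfl : a = b := funext fun q => Adjunction.ext (NatTrans.ext (funext fun c => h q c))
  rfl

lemma MndHopfParamAdj.ext' {x y : MndHopfParamAdj f g} (h : x.adj = y.adj) : x = y := by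
  cases x
  cases y
  obtain rfl := h
  rfl

/-- A Hopf parametric adjunction in `Adj_R(Cat)` between transposes is determined by its underlying
parametric adjunction. -/
lemma AdjHopfParamAdj.ext' {x y : AdjHopfParamAdj (liftLeft f) (liftRight g)}
    (h : x.adjTop = y.adjTop) : x = y := by
  have h' : x.adjBot = y.adjBot := by
    refine parametrizedAdjunction_ext fun q A => Monad.Algebra.Hom.ext ?_
    have hx := ((isAdjointObject_lift_iff q _ _).1 (x.isAdjointObject q)).1 A
    have hy := ((isAdjointObject_lift_iff q _ _).1 (y.isAdjointObject q)).1 A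
    rw [h] at hx
    exact hx.trans hy.symm
  cases x
  cases y
  obtain rfl := h
  obtain rfl := h'
  rfl

/-- Hopf parametric adjunctions between 1-cells of `Mnd(Cat)` and between their transposes in
`Adj_R(Cat)` correspond to each other. -/
def hopfParamAdjEquiv (hf : IsIso f.ψ) :
    AdjHopfParamAdj (liftLeft f) (liftRight g) ≃ MndHopfParamAdj f g where
  toFun x :=
    { isIso := hf
      adj := x.adjTop
      isAdjointObject := fun q => (mnd_isAdjointObject_iff q _).2 (by
        obtain ⟨hu, hc⟩ := (isAdjointObject_lift_iff q _ _).1 (x.isAdjointObject q)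
        refine ⟨fun A => ?_, fun B => ?_⟩
        · have h := ((x.adjBot.adj q).unit.app A).h
          rw [hu] at h
          exact h
        · have h := ((x.adjBot.adj q).counit.app B).h
          rw [hc] at h
          exact h) }
  invFun y :=
    { isIso := by
        have : IsIso ((MndHom.prodFreeHom S Q).comp f).ψ := by
          have h (c : C × Q) : IsIso (((MndHom.prodFreeHom S Q).comp f).ψ.app c) := by
            have e : ((MndHom.prodFreeHom S Q).comp f).ψ.app c = f.ψ.app c :=
              comp_map_id f.functor (f.ψ.app c)
            rw [e]
            exact inferInstanceAs (IsIso (f.ψ.app c))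
          exact NatIso.isIso_of_isIso_app _
        exact toAdjTranspose_isIso_lam _
      adjTop := y.adj
      adjBot := liftParam y
      isAdjointObject := fun q =>
        (isAdjointObject_lift_iff q _ _).2 ⟨fun _ => rfl, fun _ => rfl⟩ }
  left_inv _ := AdjHopfParamAdj.ext' rfl
  right_inv _ := MndHopfParamAdj.ext' rfl

/-- For invertible `ψ` and an adjunction `J ⊣ G`, an instance of doctrinal adjunction: `(J, ψ)` is
left adjoint to `(G, ad(ψ))` inside `Mnd(Cat)`. -/
lemma MndHom.isAdjointObject_of_adψ (f : MndHom S T) [IsIso f.ψ] (g : MndHom T S)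
    (adj : f.functor ⊣ g.functor) (hg : ∀ d, g.ψ.app d = f.adApp adj d) :
    f.IsAdjointObject g adj where
  unit c := by
    change S.map (adj.unit.app c) ≫ g.ψ.app (f.functor.obj c) ≫ g.functor.map (f.app c) =
      𝟙 (S.obj c) ≫ adj.unit.app (S.obj c)
    apply (adj.homEquiv _ _).symm.injective
    have h1 := f.invApp_naturality (adj.unit.app c)
    have h2 := adj.counit.naturality (f.app c)
    dsimp at h2
    rw [hg, Adjunction.homEquiv_counit, Adjunction.homEquiv_counit]
    simp only [Functor.map_comp, Category.assoc]
    rw [h2, reassoc_of% (f.map_adApp_counit adj (f.functor.obj c)), reassoc_of% h1,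
      ← T.map_comp_assoc, adj.left_triangle_components]
    simpa using f.invApp_app c
  counit d := by
    change T.map (adj.counit.app d) ≫ 𝟙 (T.obj d) =
      (f.app (g.functor.obj d) ≫ f.functor.map (g.ψ.app d)) ≫ adj.counit.app (T.obj d)
    rw [hg, Category.assoc, f.map_adApp_counit, ← Category.assoc, f.app_invApp]
    exact (Category.comp_id _).trans (Category.id_comp _).symm

end Lifting

end HopfParametric

theorem theorem5p2p2 {C : Type u₁} [Category.{v₁} C] {D : Type u₂} [Category.{v₂} D]
    {P : Type u₃} [Category.{v₃} P] {S : Monad C} {T : Monad D} {E : Monad P}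
    (f : MndHom (prodMonad S E) T) (hf : f.IsLeftHopf) (K : Pᵒᵖ × D ⥤ C)
    (adj : (curry.obj f.functor).flip ⊣₂ curry.obj K) :
    toMndTranspose (liftLeft f.hopfOp) = (MndHom.prodFreeHom S E.Algebra).comp f.hopfOp ∧
    toMndTranspose (liftRight (hopfSharp f hf adj)) =
      (MndHom.freeProdHom T E.Algebraᵒᵖ).comp (hopfSharp f hf adj) ∧
    ∃ Θ : AdjHopfParamAdj (liftLeft f.hopfOp) (liftRight (hopfSharp f hf adj)) ≃
        MndHopfParamAdj f.hopfOp (hopfSharp f hf adj),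
      (∀ x, (Θ x).adj = x.adjTop) ∧
      (∀ y M A, (((Θ.symm y).adjBot.adj M).unit.app A).f = (y.adj.adj M).unit.app A.A) ∧
      (∀ y M B, (((Θ.symm y).adjBot.adj M).counit.app B).f = (y.adj.adj M).counit.app B.A) ∧
      ∃ y : MndHopfParamAdj f.hopfOp (hopfSharp f hf adj), y.adj = restrictParam adj E.forget := by
  refine ⟨toMndTranspose_toAdjTranspose _, toMndTranspose_toAdjTranspose _,
    hopfParamAdjEquiv hf, fun _ => rfl, fun _ _ _ => rfl, fun _ _ _ => rfl, ?_⟩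
  have : IsIso f.hopfOp.ψ := hf
  exact ⟨⟨hf, restrictParam adj E.forget, fun q =>
    MndHom.isAdjointObject_of_adψ _ _ _ fun _ => rfl⟩, rfl⟩
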